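/- There is an absolute constant $C>0$ such that the following holds. Let $n\ge 1$, let $\Omega\subset\mathbb{R}^n$ be open, and let $V:\mathbb{R}^n\to\mathbb{R}$ be bounded and continuous with $V(x)\ge 0$ for all $x\in\mathbb{R}^n$ and $V(x)>0$ for all $x\in\Omega$. Let $u_0\in L^2(\mathbb{R}^n)$ be real-valued with $\operatorname{supp}u_0\subset\Omega$ (the support being the complement of the largest open set on which $u_0=0$ almost everywhere) and $$J_{0,h}^2:=\int_\Omega\frac{|u_0(x)|^2}{V(x)}\,dx<+\infty .$$ Then the Cauchy problem $$u_t-\Delta u+V(x)u=0\quad(t>0,\ x\in\mathbb{R}^n),\qquad u(0,x)=u_0(x)\quad(x\in\mathbb{R}^n),$$ has a unique solution $u\in C([0,\infty);L^2(\mathbb{R}^n))\cap C^1((0,\infty);L^2(\mathbb{R}^n))\cap C((0,\infty);H^2(\mathbb{R}^n))$, and it satisfies $$(1+t)\,\|u(t,\cdot)\|_{L^2(\mathbb{R}^n)}^2\le C\left(\|u_0\|_{L^2(\mathbb{R}^n)}^2+J_{0,h}^2\right)\qquad(t\ge 0).$$ -/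

import Mathlib

open MeasureTheory Set Topology
open scoped ContDiff BoundedContinuousFunction

noncomputable section

/-- The real Hilbert space `L²(ℝⁿ)` (Lebesgue measure, real-valued functions). -/
abbrev L2 (n : ℕ) : Type :=
  Lp ℝ 2 (volume : Measure (EuclideanSpace ℝ (Fin n)))

/-- The classical partial derivative `∂φ/∂xᵢ`. -/
def partialDeriv {n : ℕ} (i : Fin n) (φ : EuclideanSpace ℝ (Fin n) → ℝ)
    (x : EuclideanSpace ℝ (Fin n)) : ℝ :=
  fderiv ℝ φ x (EuclideanSpace.single i 1)

/-- `g ∈ L²(ℝⁿ)` is the weak `i`-th partial derivative of `f ∈ L²(ℝⁿ)`: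
`∫ f ∂ᵢφ = -∫ g φ` for every `φ ∈ C_c^∞(ℝⁿ)`. -/
def IsWeakPartial {n : ℕ} (i : Fin n) (f g : L2 n) : Prop :=
  ∀ φ : EuclideanSpace ℝ (Fin n) → ℝ, ContDiff ℝ ∞ φ → HasCompactSupport φ →
    ∫ x, f x * partialDeriv i φ x = -∫ x, g x * φ x

theorem integrable_L2_mul {n : ℕ} (f : L2 n) {φ : EuclideanSpace ℝ (Fin n) → ℝ}
    (hc : Continuous φ) (hs : HasCompactSupport φ) : Integrable (fun x => f x * φ x) :=
  (Lp.memLp f).integrable_mul (q := 2) (hc.memLp_of_hasCompactSupport hs)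

theorem continuous_partialDeriv {n : ℕ} (i : Fin n) {φ : EuclideanSpace ℝ (Fin n) → ℝ}
    (h : ContDiff ℝ ∞ φ) : Continuous (partialDeriv i φ) :=
  (h.continuous_fderiv (by simp)).clm_apply continuous_const

theorem hasCompactSupport_partialDeriv {n : ℕ} (i : Fin n)
    {φ : EuclideanSpace ℝ (Fin n) → ℝ} (hs : HasCompactSupport φ) :
    HasCompactSupport (partialDeriv i φ) :=
  hs.fderiv_apply ℝ (EuclideanSpace.single i 1)

theorem IsWeakPartial.zero {n : ℕ} (i : Fin n) : IsWeakPartial i (0 : L2 n) 0 := by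
  intro φ _ _
  have h : ∀ ψ : EuclideanSpace ℝ (Fin n) → ℝ, ∫ x, (0 : L2 n) x * ψ x = 0 := by
    intro ψ
    refine integral_eq_zero_of_ae ?_
    filter_upwards [Lp.coeFn_zero ℝ 2 (volume : Measure (EuclideanSpace ℝ (Fin n)))] with x hx
    rw [hx]
    exact zero_mul _
  rw [h, h, neg_zero]

theorem IsWeakPartial.add {n : ℕ} {i : Fin n} {f g f' g' : L2 n} (h : IsWeakPartial i f g)
    (h' : IsWeakPartial i f' g') : IsWeakPartial i (f + f') (g + g') := by
  intro φ hφ hs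
  have key : ∀ (a b : L2 n) (ψ : EuclideanSpace ℝ (Fin n) → ℝ), Continuous ψ →
      HasCompactSupport ψ →
      ∫ x, (a + b : L2 n) x * ψ x = (∫ x, a x * ψ x) + ∫ x, b x * ψ x := by
    intro a b ψ hc hs
    rw [← integral_add (integrable_L2_mul a hc hs) (integrable_L2_mul b hc hs)]
    refine integral_congr_ae ?_
    filter_upwards [Lp.coeFn_add a b] with x hx
    rw [hx, Pi.add_apply, add_mul]
  rw [key _ _ _ (continuous_partialDeriv i hφ) (hasCompactSupport_partialDeriv i hs),
    key _ _ _ hφ.continuous hs, h φ hφ hs, h' φ hφ hs]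
  ring

theorem IsWeakPartial.smul {n : ℕ} {i : Fin n} {f g : L2 n} (c : ℝ) (h : IsWeakPartial i f g) :
    IsWeakPartial i (c • f) (c • g) := by
  intro φ hφ hs
  have key : ∀ (a : L2 n) (ψ : EuclideanSpace ℝ (Fin n) → ℝ),
      ∫ x, (c • a : L2 n) x * ψ x = c * ∫ x, a x * ψ x := by
    intro a ψ
    rw [← integral_const_mul]
    refine integral_congr_ae ?_
    filter_upwards [Lp.coeFn_smul c a] with x hx
    rw [hx, Pi.smul_apply, smul_eq_mul, mul_assoc]
  rw [key, key, h φ hφ hs]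
  ring

/-- The Sobolev space `H²(ℝⁿ)`. A function is carried along with its (unique) weak first and second
order derivatives, `(f, ∇f, D²f)`, all in `L²(ℝⁿ)`; the norm and topology are inherited from the
product of `L²` spaces, so that the norm is equivalent to the usual `H²` norm
`(‖f‖² + ∑ ‖∂ᵢf‖² + ∑ ‖∂ⱼ∂ᵢf‖²)^{1/2}`. -/
def SobolevH2 (n : ℕ) : Submodule ℝ (L2 n × (Fin n → L2 n) × (Fin n → Fin n → L2 n)) where
  carrier := {p | (∀ i, IsWeakPartial i p.1 (p.2.1 i)) ∧
    ∀ i j, IsWeakPartial j (p.2.1 i) (p.2.2 i j)}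
  zero_mem' := ⟨fun i => .zero i, fun _ j => .zero j⟩
  add_mem' := fun h h' => ⟨fun i => (h.1 i).add (h'.1 i), fun i j => (h.2 i j).add (h'.2 i j)⟩
  smul_mem' := fun c _ h => ⟨fun i => (h.1 i).smul c, fun i j => (h.2 i j).smul c⟩

/-- The inclusion `H²(ℝⁿ) → L²(ℝⁿ)`. -/
def SobolevH2.toL2 {n : ℕ} (w : SobolevH2 n) : L2 n := w.1.1

/-- The Laplacian `Δ : H²(ℝⁿ) → L²(ℝⁿ)`, `Δw = ∑ᵢ ∂ᵢ∂ᵢw`. -/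
def SobolevH2.laplacian {n : ℕ} (w : SobolevH2 n) : L2 n := ∑ i, w.1.2.2 i i

/-- The support of an (almost everywhere defined) function on `ℝⁿ`: the complement of the largest
open set on which it vanishes almost everywhere. -/
def essSupport {n : ℕ} (f : EuclideanSpace ℝ (Fin n) → ℝ) : Set (EuclideanSpace ℝ (Fin n)) :=
  {x | ∀ U ∈ 𝓝 x, ¬ ∀ᵐ y ∂(volume.restrict U), f y = 0}

/-- `u : [0, ∞) → L²(ℝⁿ)` (the values at negative times are irrelevant) is a solution of
`u_t - Δu + V u = 0`, `u(0) = u₀` in the class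
`C([0,∞); L²) ∩ C¹((0,∞); L²) ∩ C((0,∞); H²)`. -/
structure IsHeatSolution {n : ℕ} (V : EuclideanSpace ℝ (Fin n) →ᵇ ℝ) (u₀ : L2 n)
    (u : ℝ → L2 n) : Prop where
  continuousOn : ContinuousOn u (Ici 0)
  contDiffOn : ContDiffOn ℝ 1 u (Ioi 0)
  /-- `u ∈ C((0,∞); H²)`, and the equation holds in `L²` at each positive time. -/
  equation : ∃ w : ℝ → SobolevH2 n, ContinuousOn w (Ioi 0) ∧ ∀ t, 0 < t →
    SobolevH2.toL2 (w t) = u t ∧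
      ∀ᵐ x, deriv u t x - SobolevH2.laplacian (w t) x + V x * u t x = 0
  initial : u 0 = u₀

end

/-!
For `c > 0` large, `R = (c - Δ + V)⁻¹` is a positive injective operator on `L²`, factoring through
`H²`. The continuous functional calculus of `exp (-t / r)` applied to `R` gives the semigroup
`exp (-t R⁻¹)`, and `exp (c t) exp (-t R⁻¹) u₀` solves the Cauchy problem.

Since `Δ - V` is symmetric, `⟪u p, v q⟫` depends only on `p + q` for any two solutions `u`, `v`.
This yields uniqueness, `‖u t‖² = ⟪u₀, u (2 t)⟫`, and midpoint convexity of `‖u‖²`. The weighted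
Young inequality gives `2 ⟪u₀, u s⟫ ≤ J / s + s ∫ V (u s)²`, where `∫ V (u s)² ≤ -⟪u' s, u s⟫` by
the energy identity. For `s = 2 t` the last term is absorbed because the tangent of the convex
function `‖u‖²` at `2 t` lies below it at `t`: `-2 t ⟪u' (2 t), u (2 t)⟫ ≤ ‖u t‖²`. Thus
`2 t ‖u t‖² ≤ J`.
-/

open Filter

section FunctionalCalculus

variable {A : Type*} {p : A → Prop} [NormedRing A] [StarRing A] [NormedAlgebra ℝ A]
  [IsometricContinuousFunctionalCalculus ℝ A p] {a : A}

theorem continuousOn_cfc_of_uncurry {X : Type*} [TopologicalSpace X] {s : Set X}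
    {f : X → ℝ → ℝ} (hf : ContinuousOn f.uncurry (s ×ˢ spectrum ℝ a)) :
    ContinuousOn (fun t => cfc (f t) a) s := by
  have hslice : ∀ t ∈ s, ContinuousOn (f t) (spectrum ℝ a) := fun t ht =>
    hf.comp (Continuous.prodMk_right t).continuousOn fun _ hr => ⟨ht, hr⟩
  intro t ht
  refine continuousWithinAt_cfc_fun (fun U hU => ?_)
    (eventually_mem_nhdsWithin.mono hslice)
  obtain ⟨N, hN, hNU⟩ := (ContinuousFunctionalCalculus.isCompact_spectrum a).mem_uniformity_of_prod
    hf ht (symm_le_uniformity hU)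
  exact mem_of_superset hN hNU

theorem hasDerivAt_cfc {f f' : ℝ → ℝ → ℝ} {s : Set ℝ} (hs : IsOpen s)
    (hf : ∀ t ∈ s, ContinuousOn (f t) (spectrum ℝ a))
    (hf' : ContinuousOn f'.uncurry (s ×ˢ spectrum ℝ a))
    (hderiv : ∀ t ∈ s, ∀ r ∈ spectrum ℝ a, HasDerivAt (f · r) (f' t r) t) {t : ℝ} (ht : t ∈ s) :
    HasDerivAt (fun τ => cfc (f τ) a) (cfc (f' t) a) t := by
  have hf't : ContinuousOn (f' t) (spectrum ℝ a) :=
    hf'.comp (Continuous.prodMk_right t).continuousOn fun _ hr => ⟨ht, hr⟩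
  rw [hasDerivAt_iff_isLittleO, Asymptotics.isLittleO_iff]
  intro ε hε
  obtain ⟨N, hN, hNε⟩ := (ContinuousFunctionalCalculus.isCompact_spectrum a).mem_uniformity_of_prod
    hf' ht (Metric.dist_mem_uniformity hε)
  rw [hs.nhdsWithin_eq ht] at hN
  obtain ⟨δ, hδ, hball⟩ := Metric.mem_nhds_iff.1 (inter_mem (hs.mem_nhds ht) hN)
  filter_upwards [Metric.ball_mem_nhds t hδ] with τ hτ
  have hτs := (hball hτ).1
  rw [← cfc_sub _ _ _ (hf τ hτs) (hf t ht), ← cfc_const_mul _ _ _ hf't,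
    ← cfc_sub (fun r => f τ r - f t r) (fun r => (τ - t) * f' t r) a
      ((hf τ hτs).sub (hf t ht)) (continuousOn_const.mul hf't)]
  refine norm_cfc_le (by positivity) fun r hr => ?_
  have hmvt := (convex_ball t δ).norm_image_sub_le_of_norm_hasDerivWithin_le (𝕜 := ℝ)
    (f := fun σ => f σ r - σ * f' t r) (f' := fun σ => f' σ r - f' t r)
    (fun σ hσ => ((hderiv σ (hball hσ).1 r hr).sub
      (hasDerivAt_mul_const (f' t r))).hasDerivWithinAt)
    (fun σ hσ => (hNε σ (hball hσ).2 r hr).le) (Metric.mem_ball_self hδ) hτ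
  refine (congrArg norm ?_).trans_le hmvt
  ring

end FunctionalCalculus

/-- The function `(t, r) ↦ exp (-t / r)` for `0 < t` and `0 ≤ r`, with value `0` at `r = 0`. The
functional calculus turns it into the semigroup `exp (-t a⁻¹)`, also when `a` is not invertible. -/
noncomputable def expNegDiv (t r : ℝ) : ℝ := expNegInvGlue (r / t)

/-- The `t`-derivative `-r⁻¹ exp (-t / r)` of `expNegDiv t r`, with value `0` at `r = 0`, written
as `t⁻¹` times a function of `r / t`. -/
noncomputable def expNegDivDeriv (t r : ℝ) : ℝ := -(t⁻¹ * ((r / t)⁻¹ * expNegInvGlue (r / t)))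

theorem expNegDiv_of_pos {t r : ℝ} (ht : 0 < t) (hr : 0 < r) :
    expNegDiv t r = Real.exp (-(t / r)) := by
  rw [expNegDiv, expNegInvGlue, if_neg (div_pos hr ht).not_ge, inv_div]

theorem norm_expNegDiv_le_one (t r : ℝ) : ‖expNegDiv t r‖ ≤ 1 := by
  rw [expNegDiv, Real.norm_of_nonneg (expNegInvGlue.nonneg _), expNegInvGlue]
  split_ifs with h
  · exact zero_le_one
  · exact Real.exp_le_one_iff.2 (neg_nonpos.2 (inv_nonneg.2 (not_le.1 h).le))

theorem continuous_expNegDiv (t : ℝ) : Continuous (expNegDiv t) :=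
  (expNegInvGlue.contDiff (n := 0)).continuous.comp (continuous_id.div_const t)

theorem continuousOn_expNegDivDeriv (s : Set ℝ) :
    ContinuousOn expNegDivDeriv.uncurry (Ioi 0 ×ˢ s) := by
  have hglue : Continuous fun s : ℝ => s⁻¹ * expNegInvGlue s := by
    simpa only [Polynomial.eval_X] using
      (expNegInvGlue.contDiff_polynomial_eval_inv_mul (n := 0) Polynomial.X).continuous
  have hne : ∀ q ∈ Ioi (0 : ℝ) ×ˢ s, q.1 ≠ 0 := fun q hq => (mem_Ioi.1 hq.1).ne'
  exact ((continuousOn_fst.inv₀ hne).mul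
    (hglue.comp_continuousOn (continuousOn_snd.div continuousOn_fst hne))).neg

theorem mul_expNegDivDeriv {t r : ℝ} (ht : 0 < t) : r * expNegDivDeriv t r = -expNegDiv t r := by
  rcases eq_or_ne r 0 with rfl | hr
  · simp [expNegDiv]
  · rw [expNegDivDeriv, expNegDiv]
    field_simp

theorem hasDerivAt_expNegDiv {t r : ℝ} (ht : 0 < t) (hr : 0 ≤ r) :
    HasDerivAt (expNegDiv · r) (expNegDivDeriv t r) t := by
  rcases hr.eq_or_lt with rfl | hr
  · simpa [expNegDiv, expNegDivDeriv] using hasDerivAt_const t (0 : ℝ)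
  · have hexp : HasDerivAt (fun τ => Real.exp (-(τ / r))) (Real.exp (-(t / r)) * -(1 / r)) t :=
      ((hasDerivAt_id t).div_const r).fun_neg.exp
    refine (hexp.congr_deriv ?_).congr_of_eventuallyEq
      ((lt_mem_nhds ht).mono fun τ hτ => expNegDiv_of_pos hτ hr)
    rw [← expNegDiv_of_pos ht hr, ← mul_right_inj' hr.ne', mul_expNegDivDeriv ht]
    field_simp

theorem norm_expNegDiv_mul_sub_le {t r : ℝ} (ht : 0 < t) (hr : 0 ≤ r) :
    ‖expNegDiv t r * r - r‖ ≤ t := by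
  rcases hr.eq_or_lt with rfl | hr
  · simpa using ht.le
  · have hexp := Real.add_one_le_exp (-(t / r))
    have hle := (Real.le_norm_self _).trans (norm_expNegDiv_le_one t r)
    have hmul : t / r * r = t := div_mul_cancel₀ _ hr.ne'
    rw [← expNegDiv_of_pos ht hr] at hexp
    rw [Real.norm_eq_abs, abs_le]
    constructor <;> nlinarith

theorem tendsto_apply_of_forall_norm_le {𝕜 E F ι : Type*} [NontriviallyNormedField 𝕜]
    [SeminormedAddCommGroup E] [NormedSpace 𝕜 E] [SeminormedAddCommGroup F] [NormedSpace 𝕜 F]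
    {T : ι → E →L[𝕜] F} {T₀ : E →L[𝕜] F} {l : Filter ι} {D : Set E} {M : ℝ}
    (hT : ∀ i, ‖T i‖ ≤ M) (hD : Dense D) (h : ∀ x ∈ D, Tendsto (T · x) l (𝓝 (T₀ x))) (x : E) :
    Tendsto (T · x) l (𝓝 (T₀ x)) := by
  have hequi : Equicontinuous fun i => (T i : E → F) :=
    (LipschitzWith.uniformEquicontinuous (K := M.toNNReal) _ fun i =>
      (T i).lipschitz.weaken (by
        rw [← NNReal.coe_le_coe]; exact (hT i).trans (Real.le_coe_toNNReal M))).equicontinuous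
  exact (hequi x).tendsto_of_mem_closure T₀.continuous.continuousWithinAt.tendsto h (hD x)

theorem denseRange_of_isSelfAdjoint_of_injective {𝕜 H : Type*} [RCLike 𝕜] [NormedAddCommGroup H]
    [InnerProductSpace 𝕜 H] [CompleteSpace H] {R : H →L[𝕜] H} (hR : IsSelfAdjoint R)
    (hinj : Function.Injective R) : DenseRange R := by
  have horth : R.rangeᗮ = ⊥ := by
    rw [ContinuousLinearMap.orthogonal_range, hR.adjoint_eq]
    exact LinearMap.ker_eq_bot.2 hinj
  exact (Submodule.dense_iff_topologicalClosure_eq_top (s := R.range)).2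
    ((Submodule.topologicalClosure_eq_top_iff (K := R.range)).2 horth)

section Semigroup

variable {H : Type*} [NormedAddCommGroup H] [InnerProductSpace ℂ H] [CompleteSpace H]
  {R : H →L[ℂ] H}

theorem tendsto_cfc_expNegDiv_apply (hR : R.IsPositive) (hinj : Function.Injective R) (x : H) :
    Tendsto (fun t => cfc (expNegDiv t) R x) (𝓝[>] 0) (𝓝 x) := by
  have hsa := hR.isSelfAdjoint
  have hspec : ∀ r ∈ spectrum ℝ R, 0 ≤ r := fun r hr =>
    spectrum_nonneg_of_nonneg ((ContinuousLinearMap.nonneg_iff_isPositive R).2 hR) hr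
  refine tendsto_apply_of_forall_norm_le (T₀ := .id ℂ H)
    (fun t => norm_cfc_le zero_le_one fun r _ => norm_expNegDiv_le_one t r)
    (denseRange_of_isSelfAdjoint_of_injective hsa hinj) ?_ x
  rintro _ ⟨z, rfl⟩
  have hbound : ∀ t > 0, ‖cfc (expNegDiv t) R (R z) - R z‖ ≤ t * ‖z‖ := by
    intro t ht
    have hcfc : cfc (fun r => expNegDiv t r * r - r) R = cfc (expNegDiv t) R * R - R := by
      have hcont := (continuous_expNegDiv t).continuousOn (s := spectrum ℝ R)
      rw [cfc_sub (fun r => expNegDiv t r * r) (fun r => r) R (hcont.mul continuousOn_id)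
        continuousOn_id, cfc_mul (expNegDiv t) (fun r => r) R hcont continuousOn_id, cfc_id' ℝ R]
    have hnorm : ‖cfc (expNegDiv t) R * R - R‖ ≤ t :=
      hcfc ▸ norm_cfc_le ht.le fun r hr => norm_expNegDiv_mul_sub_le ht (hspec r hr)
    exact ContinuousLinearMap.le_of_opNorm_le _ hnorm z
  refine tendsto_iff_norm_sub_tendsto_zero.2 (squeeze_zero' (.of_forall fun t => norm_nonneg _)
    (eventually_mem_nhdsWithin.mono hbound) ?_)
  exact ((continuous_mul_const ‖z‖).tendsto' _ _ (zero_mul _)).mono_left nhdsWithin_le_nhds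

theorem exists_orbit_neg_inverse (hR : R.IsPositive) (hinj : Function.Injective R) (x : H) :
    ∃ u v : ℝ → H, ContinuousOn u (Ici 0) ∧ u 0 = x ∧ ContinuousOn v (Ioi 0) ∧
      ∀ t, 0 < t → HasDerivAt u (v t) t ∧ R (v t) = -u t := by
  have hsa := hR.isSelfAdjoint
  have hspec : ∀ r ∈ spectrum ℝ R, 0 ≤ r := fun r hr =>
    spectrum_nonneg_of_nonneg ((ContinuousLinearMap.nonneg_iff_isPositive R).2 hR) hr
  have hcont := continuousOn_expNegDivDeriv (spectrum ℝ R)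
  have hderiv : ∀ t, 0 < t → HasDerivAt (fun τ => cfc (expNegDiv τ) R x)
      (cfc (expNegDivDeriv t) R x) t := fun t ht =>
    (ContinuousLinearMap.apply ℂ H x).restrictScalars ℝ |>.hasFDerivAt.comp_hasDerivAt t
      (hasDerivAt_cfc isOpen_Ioi (fun t _ => (continuous_expNegDiv t).continuousOn) hcont
        (fun t ht r hr => hasDerivAt_expNegDiv ht (hspec r hr)) (mem_Ioi.2 ht))
  refine ⟨Function.update (fun t => cfc (expNegDiv t) R x) 0 x,
    fun t => cfc (expNegDivDeriv t) R x, ?_, Function.update_self .., ?_, fun t ht => ⟨?_, ?_⟩⟩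
  · rw [continuousOn_update_iff, Ici_sdiff_left]
    exact ⟨fun t ht => (hderiv t ht).continuousAt.continuousWithinAt,
      fun _ => tendsto_cfc_expNegDiv_apply hR hinj x⟩
  · exact (continuousOn_cfc_of_uncurry hcont).clm_apply continuousOn_const
  · exact (hderiv t ht).congr_of_eventuallyEq
      ((eventually_ne_nhds ht.ne').mono fun τ hτ => Function.update_of_ne hτ ..)
  · have hmul : R * cfc (expNegDivDeriv t) R = -cfc (expNegDiv t) R := by
      have hcont_t : ContinuousOn (expNegDivDeriv t) (spectrum ℝ R) :=
        hcont.comp (Continuous.prodMk_right t).continuousOn fun _ hr => ⟨ht, hr⟩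
      calc R * cfc (expNegDivDeriv t) R
          = cfc (fun r => r * expNegDivDeriv t r) R := by
            rw [cfc_mul (fun r => r) _ R continuousOn_id hcont_t, cfc_id' ℝ R]
        _ = -cfc (expNegDiv t) R := by
            rw [← cfc_neg]
            exact cfc_congr fun r _ => mul_expNegDivDeriv ht
    rw [Function.update_of_ne ht.ne']
    exact DFunLike.congr_fun hmul x

theorem exists_orbit_smul_sub_inverse (hR : R.IsPositive) (hinj : Function.Injective R) (c : ℂ)
    (x : H) :
    ∃ u v : ℝ → H, ContinuousOn u (Ici 0) ∧ u 0 = x ∧ ContinuousOn v (Ioi 0) ∧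
      ∀ t, 0 < t → HasDerivAt u (v t) t ∧ R (c • u t - v t) = u t := by
  obtain ⟨u, v, hu, hu0, hv, huv⟩ := exists_orbit_neg_inverse hR hinj x
  have hexp : Continuous fun t : ℝ => Complex.exp (c * t) := by fun_prop
  have hexpderiv : ∀ t : ℝ,
      HasDerivAt (fun t : ℝ => Complex.exp (c * t)) (Complex.exp (c * t) * c) t := fun t => by
    simpa only [Complex.ofRealCLM_apply, Complex.ofReal_one, mul_one] using
      ((Complex.ofRealCLM.hasDerivAt (x := t)).const_mul c).cexp
  refine ⟨fun t => Complex.exp (c * t) • u t,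
    fun t => Complex.exp (c * t) • v t + (Complex.exp (c * t) * c) • u t,
    hexp.continuousOn.smul hu, by simp [hu0], (hexp.continuousOn.smul hv).add
      ((hexp.mul continuous_const).continuousOn.smul (hu.mono Ioi_subset_Ici_self)),
    fun t ht => ⟨(hexpderiv t).smul (huv t ht).1, ?_⟩⟩
  beta_reduce
  rw [mul_comm (Complex.exp _) c, mul_smul, sub_add_cancel_right, map_neg, map_smul, (huv t ht).2,
    smul_neg, neg_neg]

end Semigroup

theorem add_mul_le_of_midpoint_le {f : ℝ → ℝ} {f' x y : ℝ}
    (hmid : ∀ z ∈ segment ℝ x y, f ((x + z) / 2) ≤ (f x + f z) / 2) (hf : HasDerivAt f f' x) :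
    f x + f' * (y - x) ≤ f y := by
  set c : ℕ → ℝ := fun k => (1 / 2) ^ k
  have hc : ∀ k, 0 < c k := fun k => by positivity
  have hslope : ∀ k, (c k)⁻¹ * (f (x + c k * (y - x)) - f x) ≤ f y - f x := by
    intro k
    induction k with
    | zero => simp [c]
    | succ k ih =>
      have hz : x + c k * (y - x) ∈ segment ℝ x y :=
        segment_eq_image' ℝ x y ▸ ⟨c k, ⟨(hc k).le, pow_le_one₀ (by simp) (by norm_num)⟩, rfl⟩
      have hhalf : x + c (k + 1) * (y - x) = (x + (x + c k * (y - x))) / 2 := by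
        simp only [c, pow_succ]
        ring
      have hinv : (c (k + 1))⁻¹ = 2 * (c k)⁻¹ := by simp [c, pow_succ, mul_comm]
      refine le_trans ?_ ih
      rw [hhalf, hinv, mul_comm 2, mul_assoc]
      have := hmid _ hz
      have := hc k
      gcongr
      linarith
  have hline : HasDerivAt (fun σ => f (x + σ * (y - x))) (f' * (y - x)) 0 := by
    refine HasDerivAt.comp (h₂ := f) 0 ?_ ((hasDerivAt_mul_const (y - x)).const_add x)
    simpa using hf
  have hlim := hline.tendsto_slope_zero.comp
    (tendsto_nhdsWithin_iff.2 ⟨tendsto_pow_atTop_nhds_zero_of_lt_one (r := (1 / 2 : ℝ))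
      (by norm_num) (by norm_num), .of_forall fun k => (hc k).ne'⟩)
  have hle : f' * (y - x) ≤ f y - f x := le_of_tendsto hlim (.of_forall fun k => by
    simpa only [Function.comp_apply, smul_eq_mul, zero_add, zero_mul, add_zero] using hslope k)
  linarith

section SymmetricFlow

variable {H : Type*} [NormedAddCommGroup H] [InnerProductSpace ℝ H] {u v : ℝ → H}

/-- Two curves that are continuous on `[0, ∞)`, differentiable on `(0, ∞)` and whose derivatives are
formally adjoint to each other, as is the case for two solutions of `u' = -A u` with `A` symmetric.
The (unbounded) operator `A` enters the estimates only through this identity. -/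
structure IsSymmetricFlowPair (u v : ℝ → H) : Prop where
  continuousOn_left : ContinuousOn u (Ici 0)
  continuousOn_right : ContinuousOn v (Ici 0)
  differentiableAt_left : ∀ t, 0 < t → DifferentiableAt ℝ u t
  differentiableAt_right : ∀ t, 0 < t → DifferentiableAt ℝ v t
  inner_deriv_left : ∀ s t, 0 < s → 0 < t → inner ℝ (deriv u s) (v t) = inner ℝ (u s) (deriv v t)

namespace IsSymmetricFlowPair

theorem inner_eq_inner_initial (h : IsSymmetricFlowPair u v) {p q : ℝ} (hp : 0 ≤ p) (hq : 0 ≤ q) :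
    inner ℝ (u p) (v q) = inner ℝ (u 0) (v (p + q)) := by
  rcases hp.eq_or_lt with rfl | hp
  · rw [zero_add]
  have hcont : ContinuousOn (fun σ => inner ℝ (u σ) (v (p + q - σ))) (Icc 0 p) :=
    (h.continuousOn_left.mono Icc_subset_Ici_self).inner (𝕜 := ℝ)
      (h.continuousOn_right.comp (by fun_prop) fun σ hσ => mem_Ici.2 (by linarith [hσ.2]))
  have hderiv : ∀ σ ∈ Ioo 0 p, HasDerivAt (fun σ => inner ℝ (u σ) (v (p + q - σ))) 0 σ := by
    intro σ hσ
    have hσ' : 0 < p + q - σ := by linarith [hσ.2]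
    have hv : HasDerivAt (fun σ => v (p + q - σ)) (-deriv v (p + q - σ)) σ :=
      (h.differentiableAt_right _ hσ').hasDerivAt.comp_const_sub ..
    refine ((h.differentiableAt_left σ hσ.1).hasDerivAt.inner ℝ hv).congr_deriv ?_
    rw [inner_neg_right, h.inner_deriv_left _ _ hσ.1 hσ', neg_add_cancel]
  obtain ⟨_, _, hslope⟩ := exists_hasDerivAt_eq_slope _ _ hp hcont hderiv
  have hzero := (div_eq_zero_iff.1 hslope.symm).resolve_right (by linarith)
  rw [sub_zero, add_sub_cancel_left] at hzero
  exact sub_eq_zero.1 hzero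

theorem inner_eq_inner (h : IsSymmetricFlowPair u v) {p q p' q' : ℝ} (hp : 0 ≤ p) (hq : 0 ≤ q)
    (hp' : 0 ≤ p') (hq' : 0 ≤ q') (hsum : p + q = p' + q') :
    inner ℝ (u p) (v q) = inner ℝ (u p') (v q') := by
  rw [h.inner_eq_inner_initial hp hq, hsum, h.inner_eq_inner_initial hp' hq']

theorem eq_of_initial_eq (huv : IsSymmetricFlowPair u v) (hu : IsSymmetricFlowPair u u)
    (hv : IsSymmetricFlowPair v v) (h0 : u 0 = v 0) {t : ℝ} (ht : 0 ≤ t) : u t = v t := by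
  have h2t : 0 ≤ t + t := add_nonneg ht ht
  have hcross_right : inner ℝ (u t) (v t) = ‖v t‖ ^ 2 := by
    rw [huv.inner_eq_inner_initial ht ht, h0, ← real_inner_self_eq_norm_sq,
      hv.inner_eq_inner_initial ht ht]
  have hcross_left : inner ℝ (u t) (v t) = ‖u t‖ ^ 2 := by
    rw [huv.inner_eq_inner ht ht h2t le_rfl (add_zero _).symm, ← h0, ← real_inner_self_eq_norm_sq,
      hu.inner_eq_inner ht ht h2t le_rfl (add_zero _).symm]
  have hdist : ‖u t - v t‖ ^ 2 = 0 := by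
    rw [norm_sub_sq_real]
    linarith
  rwa [sq_eq_zero_iff, norm_sub_eq_zero_iff] at hdist

theorem norm_sq_midpoint_le (h : IsSymmetricFlowPair u u) {p q : ℝ} (hp : 0 ≤ p) (hq : 0 ≤ q) :
    ‖u ((p + q) / 2)‖ ^ 2 ≤ (‖u p‖ ^ 2 + ‖u q‖ ^ 2) / 2 := by
  have hr : 0 ≤ (p + q) / 2 := by positivity
  have hmid : inner ℝ (u p) (u q) = ‖u ((p + q) / 2)‖ ^ 2 := by
    rw [← real_inner_self_eq_norm_sq, h.inner_eq_inner hp hq hr hr (add_halves _).symm]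
  have hsq := norm_sub_sq_real (u p) (u q)
  nlinarith [sq_nonneg ‖u p - u q‖]

theorem neg_mul_inner_deriv_le (h : IsSymmetricFlowPair u u) {t : ℝ} (ht : 0 < t) :
    -(2 * t * inner ℝ (deriv u (2 * t)) (u (2 * t))) ≤ ‖u t‖ ^ 2 := by
  have hderiv := (h.differentiableAt_left (2 * t) (by positivity)).hasDerivAt.norm_sq
  have htangent := add_mul_le_of_midpoint_le (y := t) (fun z hz => ?_) hderiv
  · rw [real_inner_comm] at htangent
    nlinarith [sq_nonneg ‖u (2 * t)‖]
  · rw [segment_symm, segment_eq_Icc (by linarith)] at hz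
    exact h.norm_sq_midpoint_le (by positivity) (ht.le.trans hz.1)

theorem mul_norm_sq_le (h : IsSymmetricFlowPair u u) {J : ℝ}
    (hJ : ∀ t, 0 < t → 2 * inner ℝ (u 0) (u t) ≤ J / t - t * inner ℝ (deriv u t) (u t))
    {t : ℝ} (ht : 0 < t) : t * ‖u t‖ ^ 2 ≤ J / 2 := by
  have hinit : ‖u t‖ ^ 2 = inner ℝ (u 0) (u (2 * t)) := by
    rw [← real_inner_self_eq_norm_sq, h.inner_eq_inner_initial ht.le ht.le, two_mul]
  have hyoung : ‖u t‖ ^ 2 ≤ J / (2 * t) := by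
    linarith [hJ (2 * t) (by positivity), h.neg_mul_inner_deriv_le ht]
  rw [le_div_iff₀ (by positivity)] at hyoung
  linarith

theorem norm_sq_le_initial (h : IsSymmetricFlowPair u u)
    (hdiss : ∀ t, 0 < t → inner ℝ (deriv u t) (u t) ≤ 0) {t : ℝ} (ht : 0 ≤ t) :
    ‖u t‖ ^ 2 ≤ ‖u 0‖ ^ 2 := by
  have hderiv : ∀ s ∈ interior (Ici (0 : ℝ)), HasDerivAt (fun s => ‖u s‖ ^ 2)
      (2 * inner ℝ (u s) (deriv u s)) s := fun s hs =>
    (h.differentiableAt_left s (by simpa using hs)).hasDerivAt.norm_sq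
  refine antitoneOn_of_deriv_nonpos (f := fun s => ‖u s‖ ^ 2) (convex_Ici 0)
    (h.continuousOn_left.norm.pow 2)
    (fun s hs => (hderiv s hs).differentiableAt.differentiableWithinAt) (fun s hs => ?_)
    (mem_Ici.2 le_rfl) ht ht
  rw [(hderiv s hs).deriv, real_inner_comm]
  linarith [hdiss s (by simpa using hs)]

end IsSymmetricFlowPair

end SymmetricFlow

section MulLp

open scoped ComplexOrder

variable {α : Type*} [TopologicalSpace α] [MeasurableSpace α] [BorelSpace α]
  {μ : Measure α} {𝕜 : Type*} [RCLike 𝕜]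

/-- Multiplication by a bounded continuous function as an operator on `L²`, linear in the
function. -/
noncomputable def mulLp (μ : Measure α) : (α →ᵇ 𝕜) →ₗ[𝕜] Lp 𝕜 2 μ →L[𝕜] Lp 𝕜 2 μ where
  toFun g := (ContinuousLinearMap.mul 𝕜 𝕜).holderL μ ⊤ 2 2 ((g.memLp_top (μ := μ)).toLp g)
  map_add' _ _ := by rw [← map_add]; rfl
  map_smul' _ _ := by rw [← map_smul]; rfl

theorem coeFn_mulLp (g : α →ᵇ 𝕜) (f : Lp 𝕜 2 μ) : mulLp μ g f =ᵐ[μ] fun x => g x * f x := by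
  filter_upwards [(ContinuousLinearMap.mul 𝕜 𝕜).coeFn_holder (r := 2)
    ((g.memLp_top (μ := μ)).toLp g) f, (g.memLp_top (μ := μ)).coeFn_toLp] with x hmul hg
  rw [← hg]
  exact hmul

theorem norm_mulLp_le (g : α →ᵇ 𝕜) : ‖mulLp μ g‖ ≤ ‖g‖ := by
  have hg : ‖(g.memLp_top (μ := μ)).toLp g‖ ≤ ‖g‖ := by
    rw [Lp.norm_toLp, eLpNorm_exponent_top]
    exact ENNReal.toReal_le_of_le_ofReal (norm_nonneg _)
      (eLpNormEssSup_le_of_ae_bound (Eventually.of_forall g.norm_coe_le_norm))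
  refine ((ContinuousLinearMap.mul 𝕜 𝕜).holderL μ ⊤ 2 2).le_of_opNorm_le_of_le
    ?_ hg |>.trans_eq (one_mul _)
  exact (ContinuousLinearMap.norm_holderL_le _).trans (ContinuousLinearMap.opNorm_mul_le 𝕜 𝕜)

theorem mulLp_one : mulLp μ (1 : α →ᵇ 𝕜) = 1 := by
  ext1 f
  refine Lp.ext ?_
  filter_upwards [coeFn_mulLp 1 f] with x hx
  rw [hx, BoundedContinuousFunction.coe_one, Pi.one_apply, one_mul]
  rfl

theorem inner_mulLp_left (g : α →ᵇ 𝕜) (f f' : Lp 𝕜 2 μ) :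
    inner 𝕜 (mulLp μ g f) f' = inner 𝕜 f (mulLp μ (star g) f') := by
  rw [L2.inner_def, L2.inner_def]
  refine integral_congr_ae ?_
  filter_upwards [coeFn_mulLp g f, coeFn_mulLp (star g) f'] with x hgf hgf'
  rw [hgf, hgf', ← smul_eq_mul, ← smul_eq_mul, inner_smul_left, inner_smul_right]
  rfl

theorem re_inner_mulLp_self_nonneg {g : α →ᵇ 𝕜} (hg : ∀ x, 0 ≤ g x) (f : Lp 𝕜 2 μ) :
    0 ≤ RCLike.re (inner 𝕜 (mulLp μ g f) f) := by
  rw [L2.inner_def, ← integral_re (L2.integrable_inner _ _)]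
  refine integral_nonneg_of_ae ?_
  filter_upwards [coeFn_mulLp g f] with x hx
  obtain ⟨r, hr, hgr⟩ := RCLike.nonneg_iff_exists_ofReal.1 (hg x)
  rw [hx, ← hgr, ← smul_eq_mul, inner_smul_real_left, RCLike.smul_re]
  exact mul_nonneg hr inner_self_nonneg

theorem isPositive_mulLp {g : α →ᵇ 𝕜} (hg : ∀ x, 0 ≤ g x) : (mulLp μ g).IsPositive := by
  refine ⟨fun f f' => ?_, re_inner_mulLp_self_nonneg hg⟩
  have hstar : star g = g := by
    ext x
    exact RCLike.conj_eq_iff_im.2 (RCLike.nonneg_iff.1 (hg x)).2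
  have h := inner_mulLp_left g f f'
  rwa [hstar] at h

theorem mulLp_injective {g : α →ᵇ 𝕜} (hg : ∀ x, g x ≠ 0) : Function.Injective (mulLp μ g) := by
  refine (injective_iff_map_eq_zero _).2 fun f hf => ?_
  rw [Lp.eq_zero_iff_ae_eq_zero] at hf ⊢
  filter_upwards [hf, coeFn_mulLp g f] with x hzero hmul
  exact (mul_eq_zero.1 (hmul.symm.trans hzero)).resolve_left (hg x)

end MulLp

section Resolvent

variable {𝕜 H : Type*} [RCLike 𝕜] [NormedAddCommGroup H] [InnerProductSpace 𝕜 H]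
  {R W K : H →L[𝕜] H}

theorem isPositive_mul_of_add_mul_mul_eq_one (hR : R.IsPositive) (hW : W.IsPositive)
    (hK : K + W * R * K = 1) : (R * K).IsPositive := by
  have hKy : ∀ y, K y + W (R (K y)) = y := fun y => DFunLike.congr_fun hK y
  refine ⟨fun x y => ?_, fun x => ?_⟩
  · calc inner 𝕜 (R (K x)) y = inner 𝕜 (R (K x)) (K y) + inner 𝕜 (R (K x)) (W (R (K y))) := by
          rw [← inner_add_right, hKy]
      _ = inner 𝕜 (K x) (R (K y)) + inner 𝕜 (W (R (K x))) (R (K y)) :=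
          congr_arg₂ _ (hR.isSymmetric _ _) (hW.isSymmetric _ _).symm
      _ = inner 𝕜 x (R (K y)) := by rw [← inner_add_left, hKy]
  · have hsplit : inner 𝕜 (R (K x)) x =
        inner 𝕜 (R (K x)) (K x) + inner 𝕜 (R (K x)) (W (R (K x))) := by
      rw [← inner_add_right, hKy]
    change 0 ≤ RCLike.re (inner 𝕜 (R (K x)) x)
    rw [hsplit, map_add]
    exact add_nonneg (hR.re_inner_nonneg_left _) (hW.re_inner_nonneg_right _)

/-- For `R = (c + A)⁻¹` the operator `R * K` is the resolvent `(c + A + W)⁻¹`. -/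
theorem exists_perturbed_resolvent [CompleteSpace H] (hR : R.IsPositive)
    (hinj : Function.Injective R) (hW : W.IsPositive) (hlt : ‖W * R‖ < 1) :
    ∃ K : H →L[𝕜] H, (R * K).IsPositive ∧ Function.Injective (R * K) ∧ K + W * R * K = 1 := by
  obtain ⟨U, hU⟩ : IsUnit (1 + W * R) := by
    simpa only [sub_neg_eq_add] using
      isUnit_one_sub_of_norm_lt_one (x := -(W * R)) (by rwa [norm_neg])
  have hK : (↑U⁻¹ : H →L[𝕜] H) + W * R * ↑U⁻¹ = 1 := by
    rw [← one_add_mul, ← hU, U.mul_inv]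
  refine ⟨↑U⁻¹, isPositive_mul_of_add_mul_mul_eq_one hR hW hK, hinj.comp ?_, hK⟩
  exact Function.LeftInverse.injective (g := (U : H →L[𝕜] H)) fun y =>
    DFunLike.congr_fun U.mul_inv y

end Resolvent

section FourierDerivative

open scoped FourierTransform LineDeriv SchwartzMap
open TemperedDistribution

variable {E : Type*} [NormedAddCommGroup E] [InnerProductSpace ℝ E]

/-- The symbol `2πi⟨ξ, m⟩` of the derivative in direction `m`. -/
noncomputable def derivSymbol (m ξ : E) : ℂ := (2 * Real.pi * Complex.I) * (inner ℝ ξ m : ℝ)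

theorem continuous_derivSymbol (m : E) : Continuous (derivSymbol m) := by
  unfold derivSymbol
  fun_prop

theorem norm_derivSymbol_le (m ξ : E) : ‖derivSymbol m ξ‖ ≤ 2 * Real.pi * ‖ξ‖ * ‖m‖ := by
  have hnorm : ‖derivSymbol m ξ‖ = 2 * Real.pi * |inner ℝ ξ m| := by
    simp [derivSymbol, abs_of_pos Real.pi_pos]
  rw [hnorm, mul_assoc (2 * Real.pi)]
  exact mul_le_mul_of_nonneg_left (abs_real_inner_le_norm ξ m) (by positivity)

theorem conj_derivSymbol (m ξ : E) : (starRingEnd ℂ) (derivSymbol m ξ) = -derivSymbol m ξ := by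
  simp [derivSymbol, map_ofNat]

variable [FiniteDimensional ℝ E] [MeasurableSpace E] [BorelSpace E]

/-- `g ∈ L²` is the derivative of `f ∈ L²` in direction `m`, in the sense of tempered
distributions. -/
def IsTemperedDeriv (m : E) (f g : Lp (α := E) ℂ 2) : Prop :=
  ∂_{m} (Lp.toTemperedDistribution f : 𝓢'(E, ℂ)) = Lp.toTemperedDistribution g

theorem fourier_lineDeriv_toTemperedDistribution_apply (m : E) (f : Lp (α := E) ℂ 2)
    (φ : 𝓢(E, ℂ)) :
    𝓕 (∂_{m} (Lp.toTemperedDistribution f : 𝓢'(E, ℂ))) φ =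
      ∫ ξ, φ ξ • (derivSymbol m ξ * (𝓕 f : Lp (α := E) ℂ 2) ξ) := by
  have hinner : (fun ξ : E => ((inner ℝ ξ m : ℝ) : ℂ)).HasTemperateGrowth := by fun_prop
  rw [fourier_lineDerivOp_eq, Lp.fourier_toTemperedDistribution_eq]
  change (2 * Real.pi * Complex.I) • smulLeftCLM ℂ (fun ξ : E => ((inner ℝ ξ m : ℝ) : ℂ))
      (Lp.toTemperedDistribution (𝓕 f) : 𝓢'(E, ℂ)) φ = _
  rw [smulLeftCLM_apply_apply, Lp.toTemperedDistribution_apply, ← integral_smul]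
  refine integral_congr_ae (Eventually.of_forall fun ξ => ?_)
  simp only [SchwartzMap.smulLeftCLM_apply_apply hinner, derivSymbol, smul_eq_mul]
  ring

theorem isTemperedDeriv_iff_fourier_ae {m : E} {f g : Lp (α := E) ℂ 2} :
    IsTemperedDeriv m f g ↔
      ∀ᵐ ξ, (𝓕 g : Lp (α := E) ℂ 2) ξ = derivSymbol m ξ * (𝓕 f : Lp (α := E) ℂ 2) ξ := by
  have hiff : IsTemperedDeriv m f g ↔ ∀ φ : 𝓢(E, ℂ),
      ∫ ξ, φ ξ • (derivSymbol m ξ * (𝓕 f : Lp ℂ 2 (volume : Measure E)) ξ) =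
        ∫ ξ, φ ξ • (𝓕 g : Lp ℂ 2 (volume : Measure E)) ξ := by
    rw [IsTemperedDeriv, ← (FourierTransform.fourierEquiv ℂ 𝓢'(E, ℂ)).injective.eq_iff,
      DFunLike.ext_iff]
    refine forall_congr' fun φ => ?_
    change 𝓕 (∂_{m} (Lp.toTemperedDistribution f : 𝓢'(E, ℂ))) φ =
      𝓕 (Lp.toTemperedDistribution g : 𝓢'(E, ℂ)) φ ↔ _
    rw [fourier_lineDeriv_toTemperedDistribution_apply, Lp.fourier_toTemperedDistribution_eq,
      Lp.toTemperedDistribution_apply]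
  rw [hiff]
  refine ⟨fun h => ?_, fun h φ => integral_congr_ae ?_⟩
  · have hloc : ∀ a : Lp (α := E) ℂ 2, LocallyIntegrable a := fun a =>
      (Lp.memLp a).locallyIntegrable one_le_two
    refine ae_eq_of_integral_contDiff_smul_eq (hloc _)
      ((hloc (𝓕 f)).continuous_mul (continuous_derivSymbol m)) fun η hη hηc => ?_
    have hsupp : HasCompactSupport (Complex.ofRealCLM ∘ η) := hηc.comp_left rfl
    have hsmooth : ContDiff ℝ ∞ (Complex.ofRealCLM ∘ η) := by fun_prop
    simpa using (h (hsupp.toSchwartzMap hsmooth)).symm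
  · filter_upwards [h] with ξ hξ
    rw [hξ]

theorem IsTemperedDeriv.inner_eq_neg {m : E} {f g f' g' : Lp (α := E) ℂ 2}
    (h : IsTemperedDeriv m f g) (h' : IsTemperedDeriv m f' g') :
    inner ℂ g f' = -inner ℂ f g' := by
  rw [← Lp.inner_fourier_eq g f', ← Lp.inner_fourier_eq f g', L2.inner_def, L2.inner_def,
    ← integral_neg]
  refine integral_congr_ae ?_
  filter_upwards [isTemperedDeriv_iff_fourier_ae.1 h,
    isTemperedDeriv_iff_fourier_ae.1 h'] with ξ hξ hξ'
  rw [hξ, hξ', RCLike.inner_apply, RCLike.inner_apply, map_mul, conj_derivSymbol]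
  ring

end FourierDerivative

section Cutoff

theorem exists_seq_cutoff (E : Type*) [NormedAddCommGroup E] [NormedSpace ℝ E]
    [FiniteDimensional ℝ E] :
    ∃ X : ℕ → E → ℝ, (∀ k, ContDiff ℝ ∞ (X k)) ∧ (∀ k, HasCompactSupport (X k)) ∧
      (∀ k x, ‖X k x‖ ≤ 1) ∧ (∀ x, Tendsto (X · x) atTop (𝓝 1)) ∧
      ∃ M, ∀ k x, ‖fderiv ℝ (X k) x‖ ≤ M / ((k : ℝ) + 1) := by
  let χ : ContDiffBump (0 : E) := ⟨1, 2, one_pos, one_lt_two⟩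
  let c : ℕ → ℝ := fun k => 1 / ((k : ℝ) + 1)
  have hc0 : ∀ k, 0 < c k := fun _ => Nat.one_div_pos_of_nat
  refine ⟨fun k x => χ (c k • x), fun k => χ.contDiff.comp (contDiff_const_smul (c k)),
    fun k => χ.hasCompactSupport.comp_homeomorph (Homeomorph.smulOfNeZero (c k) (hc0 k).ne'),
    fun k x => ?_, fun x => ?_, ?_⟩
  · rw [Real.norm_of_nonneg χ.nonneg]
    exact χ.le_one
  · have hscale : Tendsto (fun k => c k • x) atTop (𝓝 0) := by
      simpa only [zero_smul] using (tendsto_one_div_add_atTop_nhds_zero_nat (𝕜 := ℝ)).smul_const x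
    have hχ := (χ.contDiff (n := 0)).continuous.tendsto 0
    rw [χ.one_of_mem_closedBall (by simp [χ])] at hχ
    exact hχ.comp hscale
  · obtain ⟨M, hM⟩ := (χ.hasCompactSupport.fderiv ℝ).exists_bound_of_continuous
      (χ.contDiff.continuous_fderiv one_ne_zero)
    refine ⟨M, fun k x => ?_⟩
    rw [fderiv_comp_smul, norm_smul, Real.norm_of_nonneg (hc0 k).le, one_div_mul_eq_div]
    exact div_le_div_of_nonneg_right (hM _) (by positivity)

theorem tendsto_integral_mul_of_norm_le {α 𝕜 : Type*} [MeasurableSpace α] {μ : Measure α}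
    [RCLike 𝕜] {F : α → 𝕜} {X : ℕ → α → 𝕜} {M : ℝ} {a : 𝕜} (hF : Integrable F μ)
    (hX : ∀ k, AEStronglyMeasurable (X k) μ) (hM : ∀ k x, ‖X k x‖ ≤ M)
    (hlim : ∀ x, Tendsto (X · x) atTop (𝓝 a)) :
    Tendsto (fun k => ∫ x, F x * X k x ∂μ) atTop (𝓝 (∫ x, F x * a ∂μ)) := by
  refine tendsto_integral_of_dominated_convergence (fun x => ‖F x‖ * M)
    (fun k => hF.aestronglyMeasurable.mul (hX k)) (hF.norm.mul_const M)
    (fun k => Eventually.of_forall fun x => ?_)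
    (Eventually.of_forall fun x => (hlim x).const_mul (F x))
  rw [norm_mul]
  exact mul_le_mul_of_nonneg_left (hM k x) (norm_nonneg _)

end Cutoff

section WeakPartial

open scoped LineDeriv SchwartzMap

variable {n : ℕ} {i : Fin n}

theorem partialDeriv_mul {φ ψ : EuclideanSpace ℝ (Fin n) → ℝ} (hφ : Differentiable ℝ φ)
    (hψ : Differentiable ℝ ψ) (x : EuclideanSpace ℝ (Fin n)) :
    partialDeriv i (φ * ψ) x = partialDeriv i φ x * ψ x + φ x * partialDeriv i ψ x := by
  rw [partialDeriv, fderiv_mul (hφ x) (hψ x), add_comm, mul_comm (partialDeriv i φ x)]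
  rfl

theorem norm_partialDeriv_le (φ : EuclideanSpace ℝ (Fin n) → ℝ) (x : EuclideanSpace ℝ (Fin n)) :
    ‖partialDeriv i φ x‖ ≤ ‖fderiv ℝ φ x‖ := by
  simpa [partialDeriv] using (fderiv ℝ φ x).le_opNorm (EuclideanSpace.single i 1)

theorem IsWeakPartial.integral_eq {f g : L2 n} (h : IsWeakPartial i f g)
    {ψ : EuclideanSpace ℝ (Fin n) → ℝ} (hψ : ContDiff ℝ ∞ ψ) (hψ2 : MemLp ψ 2)
    (hψ2' : MemLp (partialDeriv i ψ) 2) :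
    ∫ x, f x * partialDeriv i ψ x = -∫ x, g x * ψ x := by
  obtain ⟨X, hXd, hXs, hX1, hXlim, M, hM⟩ := exists_seq_cutoff (EuclideanSpace ℝ (Fin n))
  have hXm : ∀ k, AEStronglyMeasurable (X k) := fun k => (hXd k).continuous.aestronglyMeasurable
  have hdXm : ∀ k, AEStronglyMeasurable (partialDeriv i (X k)) := fun k =>
    (continuous_partialDeriv i (hXd k)).aestronglyMeasurable
  have hdXle : ∀ k x, ‖partialDeriv i (X k) x‖ ≤ M / ((k : ℝ) + 1) := fun k x =>
    (norm_partialDeriv_le _ _).trans (hM k x)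
  have hdXlim : ∀ x, Tendsto (fun k => partialDeriv i (X k) x) atTop (𝓝 0) := fun x =>
    squeeze_zero_norm (hdXle · x) (tendsto_const_nhds.div_atTop
      (tendsto_natCast_atTop_atTop.atTop_add tendsto_const_nhds))
  have hdXle' : ∀ k x, ‖partialDeriv i (X k) x‖ ≤ M := fun k x => by
    have hM0 : 0 ≤ M := by simpa using (norm_nonneg _).trans (hM 0 x)
    exact (hdXle k x).trans (div_le_self hM0 (by simp))
  have hint : ∀ (a : L2 n) {φ : EuclideanSpace ℝ (Fin n) → ℝ}, MemLp φ 2 →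
      Integrable (fun x => a x * φ x) := fun a _ hφ => (Lp.memLp a).integrable_mul (q := 2) hφ
  have hcut : ∀ k, (∫ x, f x * ψ x * partialDeriv i (X k) x) +
      ∫ x, f x * partialDeriv i ψ x * X k x = -∫ x, g x * ψ x * X k x := fun k => by
    rw [← integral_add ((hint f hψ2).mul_bdd (hdXm k) (ae_of_all _ (hdXle' k)))
      ((hint f hψ2').mul_bdd (hXm k) (ae_of_all _ (hX1 k)))]
    refine (integral_congr_ae (ae_of_all _ fun x => ?_)).trans
      ((h (X k * ψ) ((hXd k).mul hψ) (hXs k).mul_right).trans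
        (congrArg _ (integral_congr_ae (ae_of_all _ fun x => ?_))))
    · beta_reduce
      rw [partialDeriv_mul ((hXd k).differentiable (by simp)) (hψ.differentiable (by simp))]
      ring
    · simp only [Pi.mul_apply]
      ring
  have hleft := (tendsto_integral_mul_of_norm_le (hint f hψ2) hdXm hdXle' hdXlim).add
    (tendsto_integral_mul_of_norm_le (hint f hψ2') hXm hX1 hXlim)
  have hright := (tendsto_integral_mul_of_norm_le (hint g hψ2) hXm hX1 hXlim).neg
  simpa using tendsto_nhds_unique hleft (hright.congr fun k => (hcut k).symm)

/-- The complex Hilbert space `L²(ℝⁿ; ℂ)`. -/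
abbrev ComplexL2 (n : ℕ) : Type := Lp (α := EuclideanSpace ℝ (Fin n)) ℂ 2

/-- The inclusion of real-valued into complex-valued `L²` functions. -/
noncomputable def ofRealL2 (n : ℕ) : L2 n →L[ℝ] ComplexL2 n := Complex.ofRealCLM.compLpL 2 volume

/-- The real part of a complex-valued `L²` function. -/
noncomputable def reL2 (n : ℕ) : ComplexL2 n →L[ℝ] L2 n := Complex.reCLM.compLpL 2 volume

theorem coeFn_ofRealL2 (f : L2 n) : ∀ᵐ x, ofRealL2 n f x = (f x : ℂ) :=
  Complex.ofRealCLM.coeFn_compLpL f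

theorem coeFn_reL2 (f : ComplexL2 n) : ∀ᵐ x, reL2 n f x = (f x).re :=
  Complex.reCLM.coeFn_compLpL f

theorem reL2_ofRealL2 (f : L2 n) : reL2 n (ofRealL2 n f) = f := by
  refine Lp.ext ?_
  filter_upwards [coeFn_reL2 (ofRealL2 n f), coeFn_ofRealL2 f] with x hre hof
  rw [hre, hof, Complex.ofReal_re]

theorem inner_ofRealL2 (f g : L2 n) :
    inner ℂ (ofRealL2 n f) (ofRealL2 n g) = ((inner ℝ f g : ℝ) : ℂ) := by
  rw [L2.inner_def, L2.inner_def, ← integral_complex_ofReal]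
  refine integral_congr_ae ?_
  filter_upwards [coeFn_ofRealL2 f, coeFn_ofRealL2 g] with x hf hg
  rw [hf, hg]
  simp

theorem integral_schwartz_smul_ofRealL2 (L : ℂ →L[ℝ] ℝ) (f : L2 n)
    (φ : 𝓢(EuclideanSpace ℝ (Fin n), ℂ)) :
    L (∫ x, φ x • ofRealL2 n f x) = ∫ x, f x * L (φ x) := by
  have hi : Integrable (fun x => φ x • ofRealL2 n f x) :=
    (φ.memLp 2).integrable_mul (q := 2) (Lp.memLp (ofRealL2 n f))
  rw [← L.integral_comp_comm hi]
  refine integral_congr_ae ?_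
  filter_upwards [coeFn_ofRealL2 f] with x hx
  rw [hx, smul_eq_mul, mul_comm, ← Complex.real_smul, map_smul, smul_eq_mul]

theorem re_integral_schwartz_smul {Φ : 𝓢(EuclideanSpace ℝ (Fin n), ℂ)}
    {φ : EuclideanSpace ℝ (Fin n) → ℝ} (hΦ : ∀ x, Φ x = (φ x : ℂ)) (f : ComplexL2 n) :
    (∫ x, Φ x • f x).re = ∫ x, reL2 n f x * φ x := by
  have hi : Integrable (fun x => Φ x • f x) :=
    (Φ.memLp 2).integrable_mul (q := 2) (Lp.memLp f)
  rw [← Complex.reCLM_apply, ← Complex.reCLM.integral_comp_comm hi]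
  refine integral_congr_ae ?_
  filter_upwards [coeFn_reL2 f] with x hx
  rw [hx, hΦ, smul_eq_mul, Complex.reCLM_apply, Complex.re_ofReal_mul, mul_comm]

theorem partialDeriv_clm_comp_schwartz (L : ℂ →L[ℝ] ℝ) (φ : 𝓢(EuclideanSpace ℝ (Fin n), ℂ))
    (x : EuclideanSpace ℝ (Fin n)) :
    partialDeriv i (fun x => L (φ x)) x = L ((∂_{EuclideanSpace.single i (1 : ℝ)} φ) x) := by
  have hd : HasFDerivAt (fun x => L (φ x)) (L.comp (fderiv ℝ φ x)) x :=
    L.hasFDerivAt.comp x (φ.hasFDerivAt x)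
  rw [partialDeriv, hd.fderiv, SchwartzMap.lineDerivOp_apply_eq_fderiv]
  rfl

theorem IsWeakPartial.isTemperedDeriv {f g : L2 n} (h : IsWeakPartial i f g) :
    IsTemperedDeriv (EuclideanSpace.single i 1) (ofRealL2 n f) (ofRealL2 n g) := by
  rw [IsTemperedDeriv]
  ext φ
  rw [TemperedDistribution.lineDerivOp_apply_apply, map_neg, Lp.toTemperedDistribution_apply,
    Lp.toTemperedDistribution_apply]
  have hcomponent : ∀ L : ℂ →L[ℝ] ℝ,
      L (-∫ x, (∂_{EuclideanSpace.single i (1 : ℝ)} φ) x • ofRealL2 n f x) =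
        L (∫ x, φ x • ofRealL2 n g x) := by
    intro L
    rw [map_neg, integral_schwartz_smul_ofRealL2, integral_schwartz_smul_ofRealL2]
    simp_rw [← partialDeriv_clm_comp_schwartz]
    rw [h.integral_eq (ψ := fun x => L (φ x)) (L.contDiff.comp (φ.smooth ⊤))
      (L.comp_memLp' (φ.memLp 2)), neg_neg]
    exact (L.comp_memLp' ((∂_{EuclideanSpace.single i (1 : ℝ)} φ).memLp 2)).ae_eq
      (ae_of_all _ fun x => (partialDeriv_clm_comp_schwartz L φ x).symm)
  exact Complex.ext (hcomponent Complex.reCLM) (hcomponent Complex.imCLM)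

theorem IsTemperedDeriv.isWeakPartial {f g : ComplexL2 n}
    (h : IsTemperedDeriv (EuclideanSpace.single i 1) f g) :
    IsWeakPartial i (reL2 n f) (reL2 n g) := by
  intro φ hφ hs
  have hsupp : HasCompactSupport (Complex.ofRealCLM ∘ φ) := hs.comp_left rfl
  have hsmooth : ContDiff ℝ ∞ (Complex.ofRealCLM ∘ φ) := by fun_prop
  let Φ := hsupp.toSchwartzMap hsmooth
  have hdΦ : ∀ x, (∂_{EuclideanSpace.single i (1 : ℝ)} Φ) x = (partialDeriv i φ x : ℂ) := by
    intro x
    have hd : HasFDerivAt Φ (Complex.ofRealCLM.comp (fderiv ℝ φ x)) x :=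
      Complex.ofRealCLM.hasFDerivAt.comp x (hφ.differentiable (by simp) x).hasFDerivAt
    rw [SchwartzMap.lineDerivOp_apply_eq_fderiv, hd.fderiv]
    rfl
  have hre := congrArg (fun T : 𝓢'(EuclideanSpace ℝ (Fin n), ℂ) => (T Φ).re) h
  beta_reduce at hre
  rw [TemperedDistribution.lineDerivOp_apply_apply, map_neg, Lp.toTemperedDistribution_apply,
    Lp.toTemperedDistribution_apply, Complex.neg_re, re_integral_schwartz_smul hdΦ,
    re_integral_schwartz_smul fun _ => rfl] at hre
  exact neg_eq_iff_eq_neg.1 hre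

theorem IsWeakPartial.inner_eq_neg {f g f' g' : L2 n} (h : IsWeakPartial i f g)
    (h' : IsWeakPartial i f' g') : inner ℝ g f' = -inner ℝ f g' := by
  have hcomplex := h.isTemperedDeriv.inner_eq_neg h'.isTemperedDeriv
  rw [inner_ofRealL2, inner_ofRealL2] at hcomplex
  exact_mod_cast hcomplex

namespace SobolevH2

theorem inner_laplacian_left (w z : SobolevH2 n) :
    inner ℝ (laplacian w) (toL2 z) = -∑ i, inner ℝ (w.1.2.1 i) (z.1.2.1 i) := by
  rw [laplacian, sum_inner, ← Finset.sum_neg_distrib]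
  exact Finset.sum_congr rfl fun i _ => (w.2.2 i i).inner_eq_neg (z.2.1 i)

theorem inner_laplacian_comm (w z : SobolevH2 n) :
    inner ℝ (laplacian w) (toL2 z) = inner ℝ (toL2 w) (laplacian z) := by
  rw [inner_laplacian_left, real_inner_comm, inner_laplacian_left]
  simp_rw [real_inner_comm]

theorem inner_laplacian_self_nonpos (w : SobolevH2 n) :
    inner ℝ (laplacian w) (toL2 w) ≤ 0 := by
  rw [inner_laplacian_left, neg_nonpos]
  exact Finset.sum_nonneg fun i _ => real_inner_self_nonneg

end SobolevH2

end WeakPartial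

section ResolventSymbol

open BoundedContinuousFunction

variable {E : Type*} [NormedAddCommGroup E]

/-- The symbol `(c + |2πξ|²)⁻¹` of the resolvent `(c - Δ)⁻¹`, as a real-valued function. -/
noncomputable def resolventFun (c : ℝ) (ξ : E) : ℝ := (c + (2 * Real.pi * ‖ξ‖) ^ 2)⁻¹

theorem resolventFun_pos {c : ℝ} (hc : 0 < c) (ξ : E) : 0 < resolventFun c ξ := by
  unfold resolventFun
  positivity

theorem continuous_resolventFun {c : ℝ} (hc : 0 < c) : Continuous (resolventFun c : E → ℝ) := by
  unfold resolventFun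
  exact Continuous.inv₀ (by fun_prop) fun ξ => by positivity

theorem resolventFun_le {c : ℝ} (hc : 0 < c) (ξ : E) : resolventFun c ξ ≤ c⁻¹ :=
  inv_anti₀ hc (le_add_of_nonneg_right (sq_nonneg _))

theorem mul_resolventFun_le {c : ℝ} (hc : 0 < c) (ξ : E) :
    2 * Real.pi * ‖ξ‖ * resolventFun c ξ ≤ c⁻¹ + 1 := by
  have hcinv : c⁻¹ * c = 1 := inv_mul_cancel₀ hc.ne'
  have hcinv0 : 0 < c⁻¹ := inv_pos.2 hc
  rw [resolventFun, ← div_eq_mul_inv, div_le_iff₀ (by positivity)]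
  nlinarith [sq_nonneg (2 * Real.pi * ‖ξ‖ - 1),
    mul_nonneg hcinv0.le (sq_nonneg (2 * Real.pi * ‖ξ‖))]

theorem sq_mul_resolventFun_le {c : ℝ} (hc : 0 < c) (ξ : E) :
    (2 * Real.pi * ‖ξ‖) ^ 2 * resolventFun c ξ ≤ 1 := by
  rw [resolventFun, ← div_eq_mul_inv, div_le_one (by positivity)]
  exact le_add_of_nonneg_left hc.le

theorem norm_ofReal_resolventFun {c : ℝ} (hc : 0 < c) (ξ : E) :
    ‖(resolventFun c ξ : ℂ)‖ = resolventFun c ξ :=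
  Complex.norm_of_nonneg (resolventFun_pos hc ξ).le

/-- The symbol of `(c - Δ)⁻¹`. -/
noncomputable def resolventSymbol {c : ℝ} (hc : 0 < c) : E →ᵇ ℂ :=
  ofNormedAddCommGroup (fun ξ => (resolventFun c ξ : ℂ))
    (Complex.continuous_ofReal.comp (continuous_resolventFun hc)) c⁻¹ fun ξ =>
      (norm_ofReal_resolventFun hc ξ).trans_le (resolventFun_le hc ξ)

theorem norm_resolventSymbol_le {c : ℝ} (hc : 0 < c) : ‖(resolventSymbol hc : E →ᵇ ℂ)‖ ≤ c⁻¹ :=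
  norm_ofNormedAddCommGroup_le _ (inv_nonneg.2 hc.le) _

variable [InnerProductSpace ℝ E]

/-- The symbol of `∂ₘ (c - Δ)⁻¹`. -/
noncomputable def derivResolventSymbol {c : ℝ} (hc : 0 < c) (m : E) : E →ᵇ ℂ :=
  ofNormedAddCommGroup (fun ξ => derivSymbol m ξ * resolventSymbol hc ξ)
    ((continuous_derivSymbol m).mul (resolventSymbol hc).continuous) ((c⁻¹ + 1) * ‖m‖) fun ξ => by
      calc ‖derivSymbol m ξ * resolventSymbol hc ξ‖
          = ‖derivSymbol m ξ‖ * resolventFun c ξ := by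
            rw [norm_mul]
            exact congrArg _ (norm_ofReal_resolventFun hc ξ)
        _ ≤ 2 * Real.pi * ‖ξ‖ * ‖m‖ * resolventFun c ξ :=
            mul_le_mul_of_nonneg_right (norm_derivSymbol_le m ξ) (resolventFun_pos hc ξ).le
        _ = 2 * Real.pi * ‖ξ‖ * resolventFun c ξ * ‖m‖ := by ring
        _ ≤ (c⁻¹ + 1) * ‖m‖ :=
            mul_le_mul_of_nonneg_right (mul_resolventFun_le hc ξ) (norm_nonneg _)

/-- The symbol of `∂ₘ' ∂ₘ (c - Δ)⁻¹`. -/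
noncomputable def derivDerivResolventSymbol {c : ℝ} (hc : 0 < c) (m m' : E) : E →ᵇ ℂ :=
  ofNormedAddCommGroup (fun ξ => derivSymbol m' ξ * derivResolventSymbol hc m ξ)
    ((continuous_derivSymbol m').mul (derivResolventSymbol hc m).continuous) (‖m'‖ * ‖m‖)
    fun ξ => by
      have hr := (resolventFun_pos hc ξ).le
      calc ‖derivSymbol m' ξ * (derivSymbol m ξ * (resolventFun c ξ : ℂ))‖
          = ‖derivSymbol m' ξ‖ * (‖derivSymbol m ξ‖ * resolventFun c ξ) := by
            rw [norm_mul, norm_mul, norm_ofReal_resolventFun hc]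
        _ ≤ 2 * Real.pi * ‖ξ‖ * ‖m'‖ * (2 * Real.pi * ‖ξ‖ * ‖m‖ * resolventFun c ξ) := by
            gcongr <;> exact norm_derivSymbol_le _ ξ
        _ = (2 * Real.pi * ‖ξ‖) ^ 2 * resolventFun c ξ * (‖m'‖ * ‖m‖) := by ring
        _ ≤ ‖m'‖ * ‖m‖ := mul_le_of_le_one_left (by positivity) (sq_mul_resolventFun_le hc ξ)

theorem sum_derivSymbol_mul_self {ι : Type*} [Fintype ι] (b : OrthonormalBasis ι ℝ E) (ξ : E) :
    ∑ i, derivSymbol (b i) ξ * derivSymbol (b i) ξ = -(((2 * Real.pi * ‖ξ‖) ^ 2 : ℝ) : ℂ) := by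
  have hsq : ∀ i, derivSymbol (b i) ξ * derivSymbol (b i) ξ =
      -(2 * (Real.pi : ℂ)) ^ 2 * ((inner ℝ ξ (b i) ^ 2 : ℝ) : ℂ) := by
    intro i
    rw [derivSymbol, Complex.ofReal_pow]
    linear_combination 4 * (Real.pi : ℂ) ^ 2 * ((inner ℝ ξ (b i) : ℝ) : ℂ) ^ 2 * Complex.I_mul_I
  simp_rw [hsq]
  rw [← Finset.mul_sum, ← Complex.ofReal_sum, b.sum_sq_inner_left]
  push_cast
  ring

theorem sum_derivDerivResolventSymbol {c : ℝ} (hc : 0 < c) {ι : Type*} [Fintype ι]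
    (b : OrthonormalBasis ι ℝ E) :
    ∑ i, derivDerivResolventSymbol hc (b i) (b i) = (c : ℂ) • resolventSymbol hc - 1 := by
  ext ξ
  rw [BoundedContinuousFunction.coe_sum, Finset.sum_apply]
  change ∑ i, derivSymbol (b i) ξ * (derivSymbol (b i) ξ * (resolventFun c ξ : ℂ)) =
    (c : ℂ) * (resolventFun c ξ : ℂ) - 1
  have hinv : resolventFun c ξ * (c + (2 * Real.pi * ‖ξ‖) ^ 2) = 1 :=
    inv_mul_cancel₀ (by positivity)
  simp_rw [← mul_assoc]
  rw [← Finset.sum_mul, sum_derivSymbol_mul_self]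
  norm_cast
  linarith

end ResolventSymbol

section FourierMultiplier

open scoped FourierTransform ComplexOrder

variable {E : Type*} [NormedAddCommGroup E] [InnerProductSpace ℝ E] [FiniteDimensional ℝ E]
  [MeasurableSpace E] [BorelSpace E]

/-- The Fourier multiplier on `L²` with a bounded continuous symbol, linear in the symbol. -/
noncomputable def fourierMul : (E →ᵇ ℂ) →ₗ[ℂ] Lp (α := E) ℂ 2 →L[ℂ] Lp (α := E) ℂ 2 :=
  (Lp.fourierTransformₗᵢ E ℂ).symm.conjStarAlgEquiv.toAlgEquiv.toLinearMap ∘ₗ mulLp volume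

theorem fourier_fourierMul (g : E →ᵇ ℂ) (f : Lp (α := E) ℂ 2) :
    𝓕 (fourierMul g f) = mulLp volume g (𝓕 f) :=
  (Lp.fourierTransformₗᵢ E ℂ).apply_symm_apply _

theorem fourierMul_one : fourierMul (1 : E →ᵇ ℂ) = 1 := by
  change (Lp.fourierTransformₗᵢ E ℂ).symm.conjStarAlgEquiv (mulLp volume 1) = 1
  rw [mulLp_one, map_one]

theorem norm_fourierMul_le (g : E →ᵇ ℂ) : ‖fourierMul g‖ ≤ ‖g‖ := by
  refine ContinuousLinearMap.opNorm_le_bound _ (norm_nonneg _) fun f => ?_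
  rw [← Lp.norm_fourier_eq, fourier_fourierMul, ← Lp.norm_fourier_eq f]
  exact (mulLp volume g).le_of_opNorm_le (norm_mulLp_le g) _

theorem fourierMul_injective {g : E →ᵇ ℂ} (hg : ∀ x, g x ≠ 0) :
    Function.Injective (fourierMul g) :=
  (Lp.fourierTransformₗᵢ E ℂ).symm.injective.comp
    ((mulLp_injective hg).comp (Lp.fourierTransformₗᵢ E ℂ).injective)

theorem isPositive_fourierMul {g : E →ᵇ ℂ} (hg : ∀ x, 0 ≤ g x) : (fourierMul g).IsPositive :=
  (LinearMap.isPositive_linearIsometryEquiv_conj_iff (Lp.fourierTransformₗᵢ E ℂ).symm).2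
    (isPositive_mulLp hg)

theorem isTemperedDeriv_fourierMul {m : E} {g g' : E →ᵇ ℂ}
    (h : ∀ ξ, g' ξ = derivSymbol m ξ * g ξ) (f : Lp (α := E) ℂ 2) :
    IsTemperedDeriv m (fourierMul g f) (fourierMul g' f) := by
  rw [isTemperedDeriv_iff_fourier_ae, fourier_fourierMul, fourier_fourierMul]
  filter_upwards [coeFn_mulLp g (𝓕 f), coeFn_mulLp g' (𝓕 f)] with ξ hg hg'
  rw [hg, hg', h, mul_assoc]

end FourierMultiplier

section ResolventH2

open scoped ComplexOrder

variable {n : ℕ}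

/-- The resolvent `(c - Δ)⁻¹` followed by the real part, as a map into `H²`. -/
noncomputable def resolventH2 (n : ℕ) {c : ℝ} (hc : 0 < c) (f : ComplexL2 n) : SobolevH2 n :=
  ⟨(reL2 n (fourierMul (resolventSymbol hc) f),
    fun i => reL2 n (fourierMul (derivResolventSymbol hc (EuclideanSpace.single i 1)) f),
    fun i j => reL2 n (fourierMul (derivDerivResolventSymbol hc (EuclideanSpace.single i 1)
      (EuclideanSpace.single j 1)) f)),
    fun _ => (isTemperedDeriv_fourierMul (fun _ => rfl) f).isWeakPartial,
    fun _ _ => (isTemperedDeriv_fourierMul (fun _ => rfl) f).isWeakPartial⟩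

theorem continuous_resolventH2 {c : ℝ} (hc : 0 < c) : Continuous (resolventH2 n hc) := by
  refine Continuous.subtype_mk (Continuous.prodMk ?_ (Continuous.prodMk
    (continuous_pi fun i => ?_) (continuous_pi fun i => continuous_pi fun j => ?_))) _
  all_goals exact (reL2 n).continuous.comp (fourierMul _).continuous

theorem toL2_resolventH2 {c : ℝ} (hc : 0 < c) (f : ComplexL2 n) :
    SobolevH2.toL2 (resolventH2 n hc f) = reL2 n (fourierMul (resolventSymbol hc) f) := rfl

theorem laplacian_resolventH2 {c : ℝ} (hc : 0 < c) (f : ComplexL2 n) :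
    SobolevH2.laplacian (resolventH2 n hc f) =
      reL2 n ((c : ℂ) • fourierMul (resolventSymbol hc) f - f) := by
  have hsum : ∑ i, fourierMul (derivDerivResolventSymbol hc (EuclideanSpace.single i 1)
      (EuclideanSpace.single i 1)) f = (c : ℂ) • fourierMul (resolventSymbol hc) f - f := by
    have hsymbol := sum_derivDerivResolventSymbol hc (EuclideanSpace.basisFun (Fin n) ℝ)
    simp only [EuclideanSpace.basisFun_apply] at hsymbol
    rw [← _root_.sum_apply, ← map_sum, hsymbol, map_sub, map_smul, fourierMul_one]
    rfl
  exact (map_sum (reL2 n) _ _).symm.trans (congrArg (reL2 n) hsum)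

/-- A real bounded continuous function, regarded as complex-valued. -/
noncomputable def complexify {α : Type*} [TopologicalSpace α] (V : α →ᵇ ℝ) : α →ᵇ ℂ :=
  Complex.ofRealCLM.compLeftContinuousBounded α V

theorem norm_complexify {α : Type*} [TopologicalSpace α] (V : α →ᵇ ℝ) : ‖complexify V‖ = ‖V‖ := by
  simp only [BoundedContinuousFunction.norm_eq]
  exact congrArg sInf (by ext; simp [complexify])

theorem reL2_mulLp_complexify (V : EuclideanSpace ℝ (Fin n) →ᵇ ℝ) (f : ComplexL2 n) :
    reL2 n (mulLp volume (complexify V) f) = mulLp volume V (reL2 n f) := by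
  refine Lp.ext ?_
  filter_upwards [coeFn_reL2 (mulLp volume (complexify V) f), coeFn_mulLp (complexify V) f,
    coeFn_mulLp V (reL2 n f), coeFn_reL2 f] with x hre hmul hmul' hre'
  rw [hre, hmul, hmul', hre']
  exact Complex.re_ofReal_mul _ _

/-- The resolvent `(‖V‖ + 1 - Δ + V)⁻¹` factors through `(‖V‖ + 1 - Δ)⁻¹`, which maps into `H²`. -/
theorem exists_schrodinger_resolvent (V : EuclideanSpace ℝ (Fin n) →ᵇ ℝ) (hV : ∀ x, 0 ≤ V x) :
    ∃ (c : ℝ) (hc : 0 < c) (K : ComplexL2 n →L[ℂ] ComplexL2 n),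
      (fourierMul (resolventSymbol hc) * K).IsPositive ∧
      Function.Injective ⇑(fourierMul (resolventSymbol hc) * K : ComplexL2 n →L[ℂ] ComplexL2 n) ∧
      K + mulLp volume (complexify V) * fourierMul (resolventSymbol hc) * K = 1 := by
  have hc : 0 < ‖V‖ + 1 := by positivity
  refine ⟨‖V‖ + 1, hc, exists_perturbed_resolvent
    (isPositive_fourierMul fun ξ => Complex.zero_le_real.2 (resolventFun_pos hc ξ).le)
    (fourierMul_injective fun ξ => Complex.ofReal_ne_zero.2 (resolventFun_pos hc ξ).ne')
    (isPositive_mulLp fun x => Complex.zero_le_real.2 (hV x)) ?_⟩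
  calc ‖mulLp volume (complexify V) * fourierMul (resolventSymbol hc)‖
      ≤ ‖mulLp volume (complexify V)‖ * ‖fourierMul (resolventSymbol hc)‖ := norm_mul_le _ _
    _ ≤ ‖V‖ * (‖V‖ + 1)⁻¹ := by
        gcongr
        · exact (norm_mulLp_le _).trans_eq (norm_complexify V)
        · exact (norm_fourierMul_le _).trans (norm_resolventSymbol_le hc)
    _ < 1 := by
        rw [← div_eq_mul_inv, div_lt_one hc]
        exact lt_add_one _

end ResolventH2

section HeatEquation

variable {n : ℕ} {V : EuclideanSpace ℝ (Fin n) →ᵇ ℝ} {u₀ v₀ : L2 n} {u v : ℝ → L2 n}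

theorem ae_sub_add_mul_eq_zero_iff {f g h : L2 n} :
    (∀ᵐ x, f x - g x + V x * h x = 0) ↔ f = g - mulLp volume V h := by
  rw [Lp.ext_iff]
  refine eventually_congr ?_
  filter_upwards [Lp.coeFn_sub g (mulLp volume V h), coeFn_mulLp V h] with x hsub hmul
  rw [hsub, Pi.sub_apply, hmul]
  constructor <;> intro <;> linarith

theorem contDiffOn_one_of_hasDerivAt {F : Type*} [NormedAddCommGroup F] [NormedSpace ℝ F]
    {f f' : ℝ → F} {s : Set ℝ} (hs : IsOpen s) (hf : ∀ t ∈ s, HasDerivAt f (f' t) t)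
    (hf' : ContinuousOn f' s) : ContDiffOn ℝ 1 f s :=
  (contDiffOn_one_iff_derivWithin hs.uniqueDiffOn).2
    ⟨fun t ht => (hf t ht).differentiableAt.differentiableWithinAt,
      hf'.congr fun t ht => (hf t ht).hasDerivWithinAt.derivWithin (hs.uniqueDiffWithinAt ht)⟩

theorem exists_isHeatSolution (hV : ∀ x, 0 ≤ V x) (u₀ : L2 n) :
    ∃ u : ℝ → L2 n, IsHeatSolution V u₀ u := by
  obtain ⟨c, hc, K, hpos, hinj, hK⟩ := exists_schrodinger_resolvent V hV
  obtain ⟨U, U', hU, hU0, hU', hderiv⟩ :=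
    exists_orbit_smul_sub_inverse hpos hinj c (ofRealL2 n u₀)
  let y : ℝ → ComplexL2 n := fun t => (c : ℂ) • U t - U' t
  have hy : ContinuousOn y (Ioi 0) :=
    ((hU.mono Ioi_subset_Ici_self).const_smul (c : ℂ)).sub hU'
  have hyU : ∀ t, 0 < t → fourierMul (resolventSymbol hc) (K (y t)) = U t := fun t ht =>
    (hderiv t ht).2
  have hVU : ∀ t, 0 < t → mulLp volume (complexify V) (U t) = y t - K (y t) := fun t ht => by
    have hKy : K (y t) + mulLp volume (complexify V)
        (fourierMul (resolventSymbol hc) (K (y t))) = y t := DFunLike.congr_fun hK (y t)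
    rw [hyU t ht] at hKy
    exact eq_sub_of_add_eq' hKy
  have hu : ∀ t ∈ Ioi (0 : ℝ), HasDerivAt (fun t => reL2 n (U t)) (reL2 n (U' t)) t := fun t ht =>
    (reL2 n).hasFDerivAt.comp_hasDerivAt t (hderiv t ht).1
  have hu' : ContinuousOn (fun t => reL2 n (U' t)) (Ioi 0) :=
    (reL2 n).continuous.comp_continuousOn hU'
  have hw : ContinuousOn (fun t => resolventH2 n hc (K (y t))) (Ioi 0) :=
    (continuous_resolventH2 hc).comp_continuousOn (K.continuous.comp_continuousOn hy)
  refine ⟨fun t => reL2 n (U t), (reL2 n).continuous.comp_continuousOn hU,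
    contDiffOn_one_of_hasDerivAt isOpen_Ioi hu hu', ⟨_, hw, fun t ht => ⟨?_, ?_⟩⟩, ?_⟩
  · rw [toL2_resolventH2, hyU t ht]
  · rw [ae_sub_add_mul_eq_zero_iff, (hu t ht).deriv, laplacian_resolventH2, hyU t ht,
      ← reL2_mulLp_complexify, hVU t ht, ← map_sub]
    congr 1
    simp only [y]
    abel
  · rw [hU0, reL2_ofRealL2]

namespace IsHeatSolution

theorem differentiableAt (h : IsHeatSolution V u₀ u) {t : ℝ} (ht : 0 < t) :
    DifferentiableAt ℝ u t :=
  (h.contDiffOn.differentiableOn one_ne_zero).differentiableAt (Ioi_mem_nhds ht)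

theorem exists_deriv_eq (h : IsHeatSolution V u₀ u) {t : ℝ} (ht : 0 < t) :
    ∃ w : SobolevH2 n, SobolevH2.toL2 w = u t ∧
      deriv u t = SobolevH2.laplacian w - mulLp volume V (u t) := by
  obtain ⟨w, -, hw⟩ := h.equation
  exact ⟨w t, (hw t ht).1, ae_sub_add_mul_eq_zero_iff.1 (hw t ht).2⟩

theorem isSymmetricFlowPair (hu : IsHeatSolution V u₀ u) (hv : IsHeatSolution V v₀ v) :
    IsSymmetricFlowPair u v where
  continuousOn_left := hu.continuousOn
  continuousOn_right := hv.continuousOn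
  differentiableAt_left _ := hu.differentiableAt
  differentiableAt_right _ := hv.differentiableAt
  inner_deriv_left s t hs ht := by
    obtain ⟨w, hwu, hw⟩ := hu.exists_deriv_eq hs
    obtain ⟨z, hzv, hz⟩ := hv.exists_deriv_eq ht
    rw [hw, hz, inner_sub_left, inner_sub_right, inner_mulLp_left, show star V = V from rfl,
      ← hwu, ← hzv, SobolevH2.inner_laplacian_comm]

theorem eqOn (hu : IsHeatSolution V u₀ u) (hv : IsHeatSolution V u₀ v) : EqOn u v (Ici 0) :=
  fun _ ht => (hu.isSymmetricFlowPair hv).eq_of_initial_eq (hu.isSymmetricFlowPair hu)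
    (hv.isSymmetricFlowPair hv) (hu.initial.trans hv.initial.symm) ht

theorem inner_mulLp_le (h : IsHeatSolution V u₀ u) {t : ℝ} (ht : 0 < t) :
    inner ℝ (mulLp volume V (u t)) (u t) ≤ -inner ℝ (deriv u t) (u t) := by
  obtain ⟨w, hwu, hw⟩ := h.exists_deriv_eq ht
  rw [hw, inner_sub_left, ← hwu]
  linarith [SobolevH2.inner_laplacian_self_nonpos w]

theorem norm_sq_le (h : IsHeatSolution V u₀ u) (hV : ∀ x, 0 ≤ V x) {t : ℝ} (ht : 0 ≤ t) :
    ‖u t‖ ^ 2 ≤ ‖u₀‖ ^ 2 := by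
  rw [← h.initial]
  refine (h.isSymmetricFlowPair h).norm_sq_le_initial (fun s hs => ?_) ht
  have hpot : 0 ≤ inner ℝ (mulLp volume V (u s)) (u s) := re_inner_mulLp_self_nonneg hV (u s)
  linarith [h.inner_mulLp_le hs]

end IsHeatSolution

theorem two_mul_le_sq_div_add {a b ρ η : ℝ} (hρ : 0 ≤ ρ) (hη : 0 < η) (ha : ρ = 0 → a = 0) :
    2 * (a * b) ≤ a ^ 2 / ρ / η + η * (ρ * b * b) := by
  rcases hρ.eq_or_lt with rfl | hρ
  · simp [ha rfl]
  · have hsq : a ^ 2 / ρ / η + η * (ρ * b * b) - 2 * (a * b) = (a - η * ρ * b) ^ 2 / (ρ * η) := by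
      field_simp
      ring
    have hnonneg : 0 ≤ (a - η * ρ * b) ^ 2 / (ρ * η) := by positivity
    linarith

theorem two_mul_inner_le_weighted (hV : ∀ x, 0 ≤ V x) (h0 : ∀ᵐ x, V x = 0 → u₀ x = 0)
    (hint : Integrable fun x => u₀ x ^ 2 / V x) {η : ℝ} (hη : 0 < η) (f : L2 n) :
    2 * inner ℝ u₀ f ≤ (∫ x, u₀ x ^ 2 / V x) / η + η * inner ℝ (mulLp volume V f) f := by
  have hmul : ∀ a b : L2 n, Integrable fun x => a x * b x := fun a b =>
    (Lp.memLp a).integrable_mul (q := 2) (Lp.memLp b)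
  have hinner : ∀ a b : L2 n, inner ℝ a b = ∫ x, a x * b x := fun a b => by
    simp only [L2.inner_def, RCLike.inner_apply, conj_trivial, mul_comm]
  rw [hinner, hinner, ← integral_const_mul, ← integral_const_mul, ← integral_div,
    ← integral_add (hint.div_const η) ((hmul _ f).const_mul η)]
  refine integral_mono_ae ((hmul u₀ f).const_mul 2)
    ((hint.div_const η).add ((hmul _ f).const_mul η)) ?_
  filter_upwards [h0, coeFn_mulLp V f] with x hx hVf
  beta_reduce
  rw [hVf]
  exact two_mul_le_sq_div_add (hV x) hη hx

theorem IsHeatSolution.mul_norm_sq_le (h : IsHeatSolution V u₀ u) (hV : ∀ x, 0 ≤ V x)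
    (h0 : ∀ᵐ x, V x = 0 → u₀ x = 0) (hint : Integrable fun x => u₀ x ^ 2 / V x) {t : ℝ}
    (ht : 0 < t) : t * ‖u t‖ ^ 2 ≤ (∫ x, u₀ x ^ 2 / V x) / 2 := by
  refine (h.isSymmetricFlowPair h).mul_norm_sq_le (fun s hs => ?_) ht
  have hyoung := two_mul_inner_le_weighted hV h0 hint hs (u s)
  have henergy := mul_le_mul_of_nonneg_left (h.inner_mulLp_le hs) hs.le
  rw [h.initial]
  linarith

theorem ae_eq_zero_of_essSupport_subset {f : EuclideanSpace ℝ (Fin n) → ℝ}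
    {Ω : Set (EuclideanSpace ℝ (Fin n))} (h : essSupport f ⊆ Ω) : ∀ᵐ x, x ∉ Ω → f x = 0 := by
  have hnull : volume {x | ¬(x ∉ Ω → f x = 0)} = 0 := by
    refine measure_null_of_locally_null _ fun x hx => ?_
    have hxsupp : x ∉ essSupport f := fun hmem => hx fun hxΩ => absurd (h hmem) hxΩ
    simp only [essSupport, mem_ofPred_eq, not_forall, not_not] at hxsupp
    obtain ⟨U, hU, hU0⟩ := hxsupp
    obtain ⟨O, hOU, hO, hxO⟩ := mem_nhds_iff.1 hU
    refine ⟨O ∩ {z | f z ≠ 0}, mem_nhdsWithin.2 ⟨O, hO, hxO, fun z hz => ⟨hz.1, fun hz0 =>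
      hz.2 fun _ => hz0⟩⟩, ?_⟩
    have hO0 := ae_restrict_of_ae_restrict_of_subset hOU hU0
    rw [ae_iff, Measure.restrict_apply₀' hO.measurableSet.nullMeasurableSet] at hO0
    rwa [inter_comm]
  exact hnull

theorem theorem1p6_general {Ω : Set (EuclideanSpace ℝ (Fin n))} (hpos : ∀ x ∈ Ω, 0 < V x)
    (hV : ∀ x, 0 ≤ V x) (h0 : ∀ᵐ x, x ∉ Ω → u₀ x = 0)
    (hint : IntegrableOn (fun x => |u₀ x| ^ 2 / V x) Ω) :
    ∃ u : ℝ → L2 n, IsHeatSolution V u₀ u ∧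
      (∀ v : ℝ → L2 n, IsHeatSolution V u₀ v → ∀ t : ℝ, 0 ≤ t → v t = u t) ∧
      ∀ t : ℝ, 0 ≤ t → (1 + t) * ‖u t‖ ^ 2 ≤ ‖u₀‖ ^ 2 + ∫ x in Ω, |u₀ x| ^ 2 / V x := by
  have hcompl : ∀ᵐ x, x ∉ Ω → |u₀ x| ^ 2 / V x = 0 := h0.mono fun x hx hxΩ => by simp [hx hxΩ]
  have hJ : 0 ≤ ∫ x, |u₀ x| ^ 2 / V x := integral_nonneg fun x => div_nonneg (sq_nonneg _) (hV x)
  have hint' := hint.integrable_of_ae_notMem_eq_zero hcompl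
  rw [setIntegral_eq_integral_of_ae_compl_eq_zero hcompl]
  simp only [sq_abs] at hint' hJ ⊢
  have hzero : ∀ᵐ x, V x = 0 → u₀ x = 0 := h0.mono fun x hx hVx =>
    hx fun hxΩ => (hpos x hxΩ).ne' hVx
  obtain ⟨u, hu⟩ := exists_isHeatSolution hV u₀
  refine ⟨u, hu, fun v hv t ht => hv.eqOn hu ht, fun t ht => ?_⟩
  have hnorm := hu.norm_sq_le hV ht
  rcases ht.eq_or_lt with rfl | ht
  · linarith
  · linarith [hu.mul_norm_sq_le hV hzero hint' ht]

end HeatEquation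

theorem theorem1p6 :
    ∃ C : ℝ, 0 < C ∧
      ∀ (n : ℕ), 1 ≤ n → ∀ (Ω : Set (EuclideanSpace ℝ (Fin n))), IsOpen Ω →
        ∀ (V : EuclideanSpace ℝ (Fin n) →ᵇ ℝ), (∀ x ∈ Ω, 0 < V x) → (∀ x, 0 ≤ V x) →
        ∀ (u₀ : L2 n), essSupport u₀ ⊆ Ω →
        IntegrableOn (fun x => |u₀ x| ^ 2 / V x) Ω →
        ∃ u : ℝ → L2 n, IsHeatSolution V u₀ u ∧
          (∀ v : ℝ → L2 n, IsHeatSolution V u₀ v → ∀ t : ℝ, 0 ≤ t → v t = u t) ∧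
          ∀ t : ℝ, 0 ≤ t →
            (1 + t) * ‖u t‖ ^ 2 ≤ C * (‖u₀‖ ^ 2 + ∫ x in Ω, |u₀ x| ^ 2 / V x) := by
  exact ⟨1, one_pos, fun n _ Ω _ V hpos hV u₀ hsupp hint => by
    simpa only [one_mul] using
      theorem1p6_general hpos hV (ae_eq_zero_of_essSupport_subset hsupp) hint⟩
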